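/- Let $X$ be a (real or complex) Banach space, let $V$ be a bounded linear operator on $X$, and let $M\ge 1$. A bounded operator $V$ is called the cogenerator of a $C_0$-semigroup $(T(t))_{t\ge 0}$ with generator $A$ if $1\in\rho(A)$ and $V=(A+I)(A-I)^{-1}$. For $\mu\in\rho(V)$ write $R(\mu,V)=(\mu I-V)^{-1}$. Then the following conditions are equivalent. (i) $V$ is the cogenerator of a $C_0$-semigroup $(T(t))_{t\ge 0}$ on $X$ satisfying $\|T(t)\|\le M$ for all $t\ge 0$. (ii) $V-I$ is injective and has dense range, $(1,\infty)\subset\rho(V)$, and $$\bigl\|[(I-V)R(\mu,V)]^n\bigr\|\le \frac{2^nM}{(\mu+1)^n}\qquad\text{for all }\mu>1,\ n\in\mathbb{N}.$$ (iii) $V-I$ is injective and has dense range, and there exists $\mu_0>1$ such that $(1,\mu_0)\subset\rho(V)$ and $$\bigl\|[(I-V)R(\mu,V)]^n\bigr\|\le \frac{2^nM}{(\mu+1)^n}\qquad\text{for all }\mu\in(1,\mu_0),\ n\in\mathbb{N}.$$ -/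

import Mathlib

open Filter Topology
open scoped NNReal

/-- A `C₀`-semigroup (strongly continuous one-parameter semigroup) of bounded linear operators
on a normed space `X` over `𝕜`. -/
structure C0Semigroup (𝕜 X : Type*) [RCLike 𝕜] [NormedAddCommGroup X] [NormedSpace 𝕜 X] where
  /-- The operator `T(t)`, for `t ≥ 0`. -/
  op : ℝ≥0 → X →L[𝕜] X
  op_zero : op 0 = ContinuousLinearMap.id 𝕜 X
  op_add : ∀ s t : ℝ≥0, op (s + t) = (op s).comp (op t)
  continuous_orbit : ∀ x : X, Continuous fun t : ℝ≥0 => op t x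

namespace C0Semigroup

/-- `y` is the right derivative at `0` of the orbit of `x`:
`(T(h)x - x) / h → y` as `h ↓ 0`. -/
def HasGenValue {𝕜 X : Type*} [RCLike 𝕜] [NormedAddCommGroup X] [NormedSpace 𝕜 X]
    (T : C0Semigroup 𝕜 X) (x y : X) : Prop :=
  Tendsto (fun h : ℝ≥0 => (((h : ℝ) : 𝕜)⁻¹) • (T.op h x - x)) (𝓝[>] (0 : ℝ≥0)) (𝓝 y)

theorem HasGenValue.unique {𝕜 X : Type*} [RCLike 𝕜] [NormedAddCommGroup X] [NormedSpace 𝕜 X]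
    {T : C0Semigroup 𝕜 X} {x y z : X} (h : T.HasGenValue x y) (h' : T.HasGenValue x z) : y = z :=
  tendsto_nhds_unique h h'

theorem HasGenValue.add {𝕜 X : Type*} [RCLike 𝕜] [NormedAddCommGroup X] [NormedSpace 𝕜 X]
    {T : C0Semigroup 𝕜 X} {x x' y y' : X} (h : T.HasGenValue x y) (h' : T.HasGenValue x' y') :
    T.HasGenValue (x + x') (y + y') := by
  refine (Tendsto.add h h').congr fun t => ?_
  rw [← smul_add, map_add]
  congr 1
  abel

theorem HasGenValue.smul {𝕜 X : Type*} [RCLike 𝕜] [NormedAddCommGroup X] [NormedSpace 𝕜 X]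
    {T : C0Semigroup 𝕜 X} (c : 𝕜) {x y : X} (h : T.HasGenValue x y) :
    T.HasGenValue (c • x) (c • y) := by
  refine (Tendsto.const_smul h c).congr fun t => ?_
  rw [map_smul, ← smul_sub, smul_comm]

theorem HasGenValue.zero {𝕜 X : Type*} [RCLike 𝕜] [NormedAddCommGroup X] [NormedSpace 𝕜 X]
    (T : C0Semigroup 𝕜 X) : T.HasGenValue 0 0 := by
  simp [HasGenValue]

/-- The (infinitesimal) generator `A` of `T`: its domain consists of all `x` for which
`lim_{h ↓ 0} (T(h)x - x) / h` exists, and `A x` is this limit. -/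
noncomputable def generator {𝕜 X : Type*} [RCLike 𝕜] [NormedAddCommGroup X] [NormedSpace 𝕜 X]
    (T : C0Semigroup 𝕜 X) : X →ₗ.[𝕜] X where
  domain :=
    { carrier := {x | ∃ y, T.HasGenValue x y}
      add_mem' := fun ⟨_, h⟩ ⟨_, h'⟩ => ⟨_, h.add h'⟩
      zero_mem' := ⟨0, HasGenValue.zero T⟩
      smul_mem' := fun c _ ⟨_, h⟩ => ⟨_, h.smul c⟩ }
  toFun :=
    { toFun := fun x => Classical.choose x.2
      map_add' := fun x x' => (Classical.choose_spec (x + x').2).unique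
        ((Classical.choose_spec x.2).add (Classical.choose_spec x'.2))
      map_smul' := fun c x => (Classical.choose_spec (c • x).2).unique
        ((Classical.choose_spec x.2).smul c) }

end C0Semigroup

/-- `S = (A - l I)⁻¹`: the bounded operator `S` on `X` is a two-sided inverse of
`A - l I : D(A) → X`. Thus `l ∈ ρ(A)` means that such an `S` exists. -/
def IsInverseOfSub {𝕜 X : Type*} [RCLike 𝕜] [NormedAddCommGroup X] [NormedSpace 𝕜 X]
    (A : X →ₗ.[𝕜] X) (l : 𝕜) (S : X →L[𝕜] X) : Prop :=
  (∀ y : X, ∃ h : S y ∈ A.domain, A ⟨S y, h⟩ - l • S y = y) ∧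
    ∀ x : A.domain, S (A x - l • (x : X)) = x

/-- `V` is the cogenerator of `T`: with `A` the generator of `T`, one has `1 ∈ ρ(A)` and
`V = (A + I)(A - I)⁻¹`. -/
def IsCogenerator {𝕜 X : Type*} [RCLike 𝕜] [NormedAddCommGroup X] [NormedSpace 𝕜 X]
    (V : X →L[𝕜] X) (T : C0Semigroup 𝕜 X) : Prop :=
  ∃ S : X →L[𝕜] X, IsInverseOfSub T.generator 1 S ∧
    ∀ y : X, ∃ h : S y ∈ T.generator.domain, V y = T.generator ⟨S y, h⟩ + S y

/-! The Cayley transform reduces the theorem to Hille–Yosida. For λ = (μ+1)/(μ-1) one has (A - I)⁻¹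
= (V - I)/2 and R(λ, A) = (μ-1)/2 · (I - V)R(μ, V), so the power bounds say exactly ‖R(λ, A)^n‖ ≤
M/λ^n. Since λ → ∞ as μ ↓ 1, values of μ near 1 suffice.

From semigroup to bounds: in the equivalent norm sup_t ‖T(t)x‖ the semigroup is contractive and A
dissipative (`HasGenValue.mul_orbitSup_le`). In terms of V this bounds μ - V from below, which puts
(1, ∞) into ρ(V) by connectedness (`mem_resolventSet_of_lower_bound`) and, iterated, yields the
power bounds.

Conversely, the Yosida approximations λ²R(λ, A) - λ have exponentials bounded by M and converge on
the dense range of V - I, so the exponentials converge strongly to a semigroup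
(`exists_semigroup_of_tendsto`). Dissipativity identifies its generator
(`isCogenerator_of_hasGenValue`). -/

namespace C0Semigroup

/-! ### Equivalent norm and dissipativity of the generator. -/

section Generator

variable {𝕜 X : Type*} [RCLike 𝕜] [NormedAddCommGroup X] [NormedSpace 𝕜 X]

theorem HasGenValue.exists_generator_apply {T : C0Semigroup 𝕜 X} {x y : X}
    (h : T.HasGenValue x y) : ∃ hx : x ∈ T.generator.domain, T.generator ⟨x, hx⟩ = y :=
  ⟨⟨y, h⟩, HasGenValue.unique (Classical.choose_spec (⟨y, h⟩ : ∃ y, T.HasGenValue x y)) h⟩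

theorem hasGenValue_generator (T : C0Semigroup 𝕜 X) (x : T.generator.domain) :
    T.HasGenValue x (T.generator x) :=
  Classical.choose_spec x.2

theorem op_add_apply (T : C0Semigroup 𝕜 X) (s t : ℝ≥0) (x : X) :
    T.op (s + t) x = T.op s (T.op t x) := by
  rw [T.op_add, ContinuousLinearMap.comp_apply]

/-- For a bounded semigroup, an equivalent norm in which the semigroup is contractive. -/
noncomputable def orbitSup (T : C0Semigroup 𝕜 X) (x : X) : ℝ := ⨆ t : ℝ≥0, ‖T.op t x‖

variable {T : C0Semigroup 𝕜 X} {M : ℝ}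

theorem bddAbove_orbit (hT : ∀ t, ‖T.op t‖ ≤ M) (x : X) :
    BddAbove (Set.range fun t : ℝ≥0 => ‖T.op t x‖) := by
  refine ⟨M * ‖x‖, ?_⟩
  rintro _ ⟨t, rfl⟩
  exact (T.op t).le_of_opNorm_le (hT t) x

theorem norm_op_le_orbitSup (hT : ∀ t, ‖T.op t‖ ≤ M) (t : ℝ≥0) (x : X) :
    ‖T.op t x‖ ≤ T.orbitSup x :=
  le_ciSup (bddAbove_orbit hT x) t

theorem norm_le_orbitSup (hT : ∀ t, ‖T.op t‖ ≤ M) (x : X) : ‖x‖ ≤ T.orbitSup x := by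
  simpa [T.op_zero] using norm_op_le_orbitSup hT 0 x

theorem orbitSup_le (hT : ∀ t, ‖T.op t‖ ≤ M) (x : X) : T.orbitSup x ≤ M * ‖x‖ :=
  ciSup_le fun t => (T.op t).le_of_opNorm_le (hT t) x

theorem orbitSup_op_le (hT : ∀ t, ‖T.op t‖ ≤ M) (h : ℝ≥0) (x : X) :
    T.orbitSup (T.op h x) ≤ T.orbitSup x :=
  ciSup_le fun t => by
    rw [← op_add_apply]
    exact norm_op_le_orbitSup hT _ _

theorem orbitSup_add_le (hT : ∀ t, ‖T.op t‖ ≤ M) (x y : X) :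
    T.orbitSup (x + y) ≤ T.orbitSup x + T.orbitSup y :=
  ciSup_le fun t => by
    rw [map_add]
    exact (norm_add_le _ _).trans
      (add_le_add (norm_op_le_orbitSup hT _ _) (norm_op_le_orbitSup hT _ _))

theorem orbitSup_smul (T : C0Semigroup 𝕜 X) (c : 𝕜) (x : X) :
    T.orbitSup (c • x) = ‖c‖ * T.orbitSup x := by
  simp only [orbitSup, map_smul, norm_smul]
  rw [Real.mul_iSup_of_nonneg (norm_nonneg c)]

/-- The generator is dissipative with respect to `orbitSup`. -/
theorem HasGenValue.mul_orbitSup_le (hT : ∀ t, ‖T.op t‖ ≤ M) {x y : X} (hxy : T.HasGenValue x y)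
    {l : ℝ} (hl : 0 ≤ l) : l * T.orbitSup x ≤ T.orbitSup ((l : 𝕜) • x - y) := by
  have hlim : Tendsto (fun h : ℝ≥0 => T.orbitSup ((l : 𝕜) • x - y) +
      M * ‖y - (((h : ℝ) : 𝕜)⁻¹) • (T.op h x - x)‖) (𝓝[>] (0 : ℝ≥0))
      (𝓝 (T.orbitSup ((l : 𝕜) • x - y) + M * ‖y - y‖)) :=
    tendsto_const_nhds.add ((tendsto_const_nhds.sub hxy).norm.const_mul M)
  rw [sub_self, norm_zero, mul_zero, add_zero] at hlim
  refine ge_of_tendsto hlim ?_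
  filter_upwards [self_mem_nhdsWithin] with h hh
  have hpos : (0 : ℝ) < h := hh
  have hne : ((h : ℝ) : 𝕜) ≠ 0 := by exact_mod_cast hpos.ne'
  set e : X := y - (((h : ℝ) : 𝕜)⁻¹) • (T.op h x - x) with he
  -- The error `e` tends to 0 with `h`. Taking `orbitSup` of both sides, the contraction `T.op h`
  -- absorbs the summand 1 on the left.
  have hdecomp : ((1 + h * l : ℝ) : 𝕜) • x =
      T.op h x + ((h : ℝ) : 𝕜) • (((l : 𝕜) • x - y) + e) := by
    rw [he, sub_add_sub_cancel, smul_sub, smul_inv_smul₀ hne, smul_smul]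
    push_cast
    rw [add_smul, one_smul]
    abel
  have h1 : (1 + h * l) * T.orbitSup x = T.orbitSup (((1 + h * l : ℝ) : 𝕜) • x) := by
    rw [orbitSup_smul, RCLike.norm_ofReal, abs_of_nonneg (by positivity)]
  have h2 := orbitSup_add_le hT (T.op h x) (((h : ℝ) : 𝕜) • (((l : 𝕜) • x - y) + e))
  rw [← hdecomp, ← h1, orbitSup_smul, RCLike.norm_ofReal, abs_of_pos hpos] at h2
  have h3 := orbitSup_op_le hT h x
  have h4 := orbitSup_add_le hT ((l : 𝕜) • x - y) e
  have h5 := orbitSup_le hT e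
  have h6 : (h : ℝ) * (l * T.orbitSup x) ≤ h * T.orbitSup (((l : 𝕜) • x - y) + e) := by linarith
  linarith [le_of_mul_le_mul_left h6 hpos]

end Generator

/-! ### Density of the domain of the generator. -/

section Density

variable {𝕜 X : Type*} [RCLike 𝕜] [NormedAddCommGroup X] [NormedSpace 𝕜 X] [CompleteSpace X]
  [NormedSpace ℝ X] [IsScalarTower ℝ 𝕜 X]

/-- The difference quotient is the average of the orbit over [t, t+h] minus that over [0, h]. -/
theorem hasGenValue_integral (T : C0Semigroup 𝕜 X) (x : X) {t : ℝ} (ht : 0 ≤ t) :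
    T.HasGenValue (∫ s in (0 : ℝ)..t, T.op s.toNNReal x) (T.op t.toNNReal x - x) := by
  set f : ℝ → X := fun s => T.op s.toNNReal x with hf
  have hc : Continuous f := (T.continuous_orbit x).comp continuous_real_toNNReal
  have hd : ∀ b, HasDerivAt (fun u => ∫ s in (0 : ℝ)..u, f s) (f b) b := fun b =>
    intervalIntegral.integral_hasDerivAt_right (hc.intervalIntegrable _ _)
      (hc.stronglyMeasurableAtFilter _ _) hc.continuousAt
  have hlim := (hd t).tendsto_slope_zero_right.sub (hd 0).tendsto_slope_zero_right
  have hcoe : Tendsto (fun h : ℝ≥0 => (h : ℝ)) (𝓝[>] (0 : ℝ≥0)) (𝓝[>] (0 : ℝ)) := by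
    refine tendsto_nhdsWithin_iff.2 ⟨?_, ?_⟩
    · exact (NNReal.continuous_coe.tendsto' 0 0 rfl).mono_left nhdsWithin_le_nhds
    · filter_upwards [self_mem_nhdsWithin] with h hh
      exact hh
  have hf0 : f 0 = x := by simp [hf, T.op_zero]
  rw [hf0] at hlim
  refine (hlim.comp hcoe).congr fun h => ?_
  have hshift : T.op h (∫ s in (0 : ℝ)..t, f s) = ∫ s in (h : ℝ)..(t + h), f s := by
    rw [← ContinuousLinearMap.intervalIntegral_comp_comm _ (hc.intervalIntegrable _ _)]
    have := intervalIntegral.integral_comp_add_right (a := 0) (b := t) f (h : ℝ)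
    rw [zero_add] at this
    rw [← this]
    refine intervalIntegral.integral_congr fun s hs => ?_
    rw [Set.uIcc_of_le ht] at hs
    simp only [hf]
    rw [← op_add_apply, Real.toNNReal_add (r := s) (p := (h : ℝ)) hs.1 h.2, Real.toNNReal_coe,
      add_comm]
  rw [hshift, ← intervalIntegral.integral_interval_sub_left (hc.intervalIntegrable 0 (t + h))
    (hc.intervalIntegrable 0 h)]
  simp only [Function.comp_apply, zero_add, intervalIntegral.integral_same, sub_zero]
  rw [← smul_sub, RCLike.real_smul_eq_coe_smul (K := 𝕜), RCLike.ofReal_inv]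
  congr 1
  abel

/-- The averages of the orbit over [0, t] lie in the domain and tend to x as t ↓ 0. -/
theorem dense_generator_domain (T : C0Semigroup 𝕜 X) :
    Dense (T.generator.domain : Set X) := by
  intro x
  set f : ℝ → X := fun s => T.op s.toNNReal x with hf
  have hc : Continuous f := (T.continuous_orbit x).comp continuous_real_toNNReal
  have hd : HasDerivAt (fun u => ∫ s in (0 : ℝ)..u, f s) (f 0) 0 :=
    intervalIntegral.integral_hasDerivAt_right (hc.intervalIntegrable _ _)
      (hc.stronglyMeasurableAtFilter _ _) hc.continuousAt
  have hlim := hd.tendsto_slope_zero_right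
  have hf0 : f 0 = x := by simp [hf, T.op_zero]
  rw [hf0] at hlim
  refine mem_closure_of_tendsto hlim ?_
  filter_upwards [self_mem_nhdsWithin] with t ht
  simp only [zero_add, intervalIntegral.integral_same, sub_zero]
  rw [RCLike.real_smul_eq_coe_smul (K := 𝕜)]
  exact Submodule.smul_mem _ _ ⟨_, hasGenValue_integral T x (le_of_lt ht)⟩

end Density

end C0Semigroup

/-! ### Continuation of the resolvent set along (1, ∞). -/

section Resolvent

variable {𝕜 X : Type*} [RCLike 𝕜] [NormedAddCommGroup X] [NormedSpace 𝕜 X] [CompleteSpace X]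

/-- A perturbation of an operator of the resolvent set that is bounded below. -/
theorem mem_resolventSet_of_antilipschitz {V : X →L[𝕜] X} {μ ν : 𝕜} {c : ℝ}
    (hν : ν ∈ resolventSet 𝕜 V) (hc : 0 < c) (hlow : ∀ y : X, c * ‖y‖ ≤ ‖ν • y - V y‖)
    (hlt : ‖ν - μ‖ < c) : μ ∈ resolventSet 𝕜 V := by
  have hu := spectrum.mem_resolventSet_iff.1 hν
  set W : X →L[𝕜] X := algebraMap 𝕜 (X →L[𝕜] X) ν - V with hW
  have hWi : W * Ring.inverse W = 1 := Ring.mul_inverse_cancel _ hu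
  have hnorm : ‖Ring.inverse W‖ ≤ c⁻¹ := by
    refine ContinuousLinearMap.opNorm_le_bound _ (by positivity) fun z => ?_
    have h1 := hlow (Ring.inverse W z)
    have h2 : W (Ring.inverse W z) = z := by
      rw [← mul_apply_eq_comp, hWi, one_apply_eq_self]
    have h3 : ν • Ring.inverse W z - V (Ring.inverse W z) = z := by
      conv_rhs => rw [← h2]
      simp [hW, Algebra.algebraMap_eq_smul_one]
    rw [h3] at h1
    rw [inv_mul_eq_div, le_div_iff₀ hc]
    linarith
  have hsmall : ‖(ν - μ) • Ring.inverse W‖ < 1 := by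
    rw [norm_smul]
    calc ‖ν - μ‖ * ‖Ring.inverse W‖ ≤ ‖ν - μ‖ * c⁻¹ := by gcongr
      _ < c * c⁻¹ := by gcongr
      _ = 1 := mul_inv_cancel₀ hc.ne'
  rw [spectrum.mem_resolventSet_iff]
  -- The second factor is invertible by the Neumann series.
  have hfac : algebraMap 𝕜 (X →L[𝕜] X) μ - V = W * (1 - (ν - μ) • Ring.inverse W) := by
    rw [mul_sub, mul_smul_comm, hWi, mul_one, hW, Algebra.algebraMap_eq_smul_one,
      Algebra.algebraMap_eq_smul_one, sub_smul]
    abel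
  rw [hfac]
  exact hu.mul (isUnit_one_sub_of_norm_lt_one hsmall)

/-- Half-line version of the continuation of resolvents: an a priori lower bound, locally uniform
on `(1, ∞)`, puts the half-line into the resolvent set. -/
theorem mem_resolventSet_of_lower_bound {V : X →L[𝕜] X} {c : ℝ} (hc : 0 < c)
    (hlow : ∀ μ : ℝ, 1 < μ → ∀ y : X, c * (μ - 1) * ‖y‖ ≤ ‖(μ : 𝕜) • y - V y‖)
    {μ : ℝ} (hμ : 1 < μ) : (μ : 𝕜) ∈ resolventSet 𝕜 V := by
  set u : Set ℝ := {μ : ℝ | (μ : 𝕜) ∈ resolventSet 𝕜 V} with hu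
  have hopen : IsOpen u := (spectrum.isOpen_resolventSet V).preimage RCLike.continuous_ofReal
  have hne : (Set.Ioi (1 : ℝ) ∩ u).Nonempty := by
    -- The factor ‖1‖ covers the trivial space, where it is 0.
    refine ⟨‖V‖ * ‖(1 : X →L[𝕜] X)‖ + 2, ?_, ?_⟩
    · have : 0 ≤ ‖V‖ * ‖(1 : X →L[𝕜] X)‖ := by positivity
      simp only [Set.mem_Ioi]
      linarith
    · refine spectrum.mem_resolventSet_of_norm_lt_mul ?_
      rw [RCLike.norm_ofReal, abs_of_nonneg (by positivity)]
      linarith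
  refine isPreconnected_Ioi.subset_of_closure_inter_subset hopen hne ?_ hμ
  rintro a ⟨ha, ha1 : 1 < a⟩
  have hcont : ContinuousAt (fun b : ℝ => c * (b - 1) - |b - a|) a := by fun_prop
  have hev : ∀ᶠ b in 𝓝 a, 0 < c * (b - 1) - |b - a| := by
    refine hcont.eventually (lt_mem_nhds ?_)
    simpa using mul_pos hc (sub_pos.2 ha1)
  -- `b` is in the resolvent set and closer to `a` than its own lower-bound constant c(b - 1).
  obtain ⟨b, ⟨hb0, hb1⟩, hb⟩ := mem_closure_iff_nhds.1 ha _ (hev.and (lt_mem_nhds ha1))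
  refine mem_resolventSet_of_antilipschitz (V := V) hb
    (mul_pos hc (sub_pos.2 hb1)) (hlow b hb1) ?_
  rw [← RCLike.ofReal_sub, RCLike.norm_ofReal]
  linarith

end Resolvent

/-! ### From the semigroup to the resolvent bounds for V. -/

section Cogenerator

variable {𝕜 X : Type*} [RCLike 𝕜] [NormedAddCommGroup X] [NormedSpace 𝕜 X]

/-- With S = (A - I)⁻¹, V y - y = 2 S y and A(2 S y) = V y + y. The estimates below use the
cogenerator only through this relation. -/
theorem IsCogenerator.hasGenValue {V : X →L[𝕜] X} {T : C0Semigroup 𝕜 X}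
    (h : IsCogenerator V T) (y : X) : T.HasGenValue (V y - y) (V y + y) := by
  obtain ⟨S, ⟨hS, -⟩, hV⟩ := h
  obtain ⟨hy, hSy⟩ := hS y
  obtain ⟨_, hVy⟩ := hV y
  rw [one_smul] at hSy
  have hA := T.hasGenValue_generator ⟨S y, hy⟩
  have h2 := hA.smul (2 : 𝕜)
  have e : T.generator ⟨S y, hy⟩ = y + S y := eq_add_of_sub_eq hSy
  rw [e] at hVy h2
  convert h2 using 1
  · rw [hVy, two_smul]; abel
  · rw [hVy, two_smul]; abel

theorem IsCogenerator.injective {V : X →L[𝕜] X} {T : C0Semigroup 𝕜 X}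
    (h : IsCogenerator V T) : Function.Injective (V - 1 : X →L[𝕜] X) := by
  refine (injective_iff_map_eq_zero _).2 fun y hy => ?_
  have hy' : V y - y = 0 := by simpa using hy
  have h1 := h.hasGenValue y
  rw [hy'] at h1
  have h2 := h1.unique (C0Semigroup.HasGenValue.zero T)
  have h3 : (2 : 𝕜) • y = 0 := by
    rw [two_smul]
    nth_rewrite 1 [← sub_eq_zero.1 hy']
    exact h2
  exact (smul_eq_zero.1 h3).resolve_left two_ne_zero

theorem IsCogenerator.domain_subset_range {V : X →L[𝕜] X} {T : C0Semigroup 𝕜 X}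
    (h : IsCogenerator V T) :
    (T.generator.domain : Set X) ⊆ Set.range (V - 1 : X →L[𝕜] X) := by
  obtain ⟨S, ⟨hS, hS'⟩, hV⟩ := h
  intro x hx
  set w := T.generator ⟨x, hx⟩ - x with hw
  have hSw : S w = x := by simpa only [one_smul] using hS' ⟨x, hx⟩
  obtain ⟨hy, hSy⟩ := hS w
  obtain ⟨_, hVy⟩ := hV w
  have hVw : V w - w = (2 : 𝕜) • x := by
    rw [one_smul] at hSy
    rw [hVy, eq_add_of_sub_eq hSy, hSw, two_smul]
    abel
  refine ⟨(2 : 𝕜)⁻¹ • w, ?_⟩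
  rw [map_smul, sub_apply, one_apply_eq_self, hVw,
    inv_smul_smul₀ two_ne_zero]

/-- Dissipativity at λ = (μ+1)/(μ-1), applied to (μ-1)(y - V y), which λ - A sends to 2(μ y - V y).
-/
theorem IsCogenerator.mul_orbitSup_le {V : X →L[𝕜] X} {T : C0Semigroup 𝕜 X} {M : ℝ}
    (h : IsCogenerator V T) (hT : ∀ t, ‖T.op t‖ ≤ M) {μ : ℝ} (hμ : 1 < μ) (y : X) :
    (μ + 1) * T.orbitSup (y - V y) ≤ 2 * T.orbitSup ((μ : 𝕜) • y - V y) := by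
  have hpos : 0 < μ - 1 := sub_pos.2 hμ
  have h1 := (h.hasGenValue y).smul (((1 - μ : ℝ)) : 𝕜)
  have h2 := h1.mul_orbitSup_le hT (l := (μ + 1) / (μ - 1)) (by positivity)
  have e1 : ((1 - μ : ℝ) : 𝕜) • (V y - y) = ((μ - 1 : ℝ) : 𝕜) • (y - V y) := by
    rw [← neg_sub μ 1, ← neg_sub y (V y), RCLike.ofReal_neg, neg_smul_neg]
  have e2 : (((μ + 1) / (μ - 1) : ℝ) : 𝕜) • ((1 - μ : ℝ) : 𝕜) • (V y - y) -
      ((1 - μ : ℝ) : 𝕜) • (V y + y) = (2 : 𝕜) • ((μ : 𝕜) • y - V y) := by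
    rw [e1, smul_smul, ← RCLike.ofReal_mul, div_mul_cancel₀ _ hpos.ne']
    push_cast
    module
  rw [e2, e1, C0Semigroup.orbitSup_smul, C0Semigroup.orbitSup_smul, RCLike.norm_ofReal,
    abs_of_pos hpos, ← mul_assoc, div_mul_cancel₀ _ hpos.ne', RCLike.norm_two] at h2
  exact h2

/-- Split (μ-1)y = (μ y - V y) - (y - V y); as 2/(μ+1) < 1, the last term is at most M‖μ y - V y‖.
-/
theorem IsCogenerator.lower_bound {V : X →L[𝕜] X} {T : C0Semigroup 𝕜 X} {M : ℝ} (hM : 0 ≤ M)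
    (h : IsCogenerator V T) (hT : ∀ t, ‖T.op t‖ ≤ M) {μ : ℝ} (hμ : 1 < μ) (y : X) :
    (1 + M)⁻¹ * (μ - 1) * ‖y‖ ≤ ‖(μ : 𝕜) • y - V y‖ := by
  have h1 := h.mul_orbitSup_le hT hμ y
  have h2 := C0Semigroup.norm_le_orbitSup hT (y - V y)
  have h3 := C0Semigroup.orbitSup_le hT ((μ : 𝕜) • y - V y)
  have h4 : ‖y - V y‖ ≤ M * ‖(μ : 𝕜) • y - V y‖ := by
    nlinarith [norm_nonneg (y - V y)]
  have h5 : (μ - 1) * ‖y‖ ≤ ‖(μ : 𝕜) • y - V y‖ + ‖y - V y‖ := by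
    have : ((μ - 1 : ℝ) : 𝕜) • y = ((μ : 𝕜) • y - V y) - (y - V y) := by
      push_cast
      module
    calc (μ - 1) * ‖y‖ = ‖((μ - 1 : ℝ) : 𝕜) • y‖ := by
          rw [norm_smul, RCLike.norm_ofReal, abs_of_pos (sub_pos.2 hμ)]
      _ ≤ _ := by rw [this]; exact norm_sub_le _ _
  rw [mul_assoc, inv_mul_eq_div, div_le_iff₀ (by linarith)]
  linarith

/-- Iterating in `orbitSup` costs no constant; M enters once, on returning to the original norm. -/
theorem IsCogenerator.norm_pow_le {V : X →L[𝕜] X} {T : C0Semigroup 𝕜 X} {M : ℝ} (hM : 0 ≤ M)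
    (h : IsCogenerator V T) (hT : ∀ t, ‖T.op t‖ ≤ M) {μ : ℝ} (hμ : 1 < μ)
    (hρ : (μ : 𝕜) ∈ resolventSet 𝕜 V) (n : ℕ) :
    ‖((1 - V) * resolvent V (μ : 𝕜)) ^ n‖ ≤ 2 ^ n * M / (μ + 1) ^ n := by
  have hpos : 0 < μ + 1 := by linarith
  have hstep : ∀ z : X, T.orbitSup (((1 - V) * resolvent V (μ : 𝕜)) z) ≤
      2 / (μ + 1) * T.orbitSup z := by
    intro z
    have h1 := h.mul_orbitSup_le hT hμ (resolvent V (μ : 𝕜) z)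
    have h2 : (algebraMap 𝕜 (X →L[𝕜] X) μ - V) * resolvent V (μ : 𝕜) = 1 :=
      Ring.mul_inverse_cancel _ (spectrum.mem_resolventSet_iff.1 hρ)
    have h3 : (μ : 𝕜) • resolvent V (μ : 𝕜) z - V (resolvent V (μ : 𝕜) z) = z := by
      have := DFunLike.congr_fun h2 z
      simpa [Algebra.algebraMap_eq_smul_one] using this
    rw [h3] at h1
    rw [div_mul_eq_mul_div, le_div_iff₀ hpos]
    simp only [mul_apply_eq_comp, sub_apply,
      one_apply_eq_self]
    linarith
  have hiter : ∀ n : ℕ, ∀ z : X, T.orbitSup ((((1 - V) * resolvent V (μ : 𝕜)) ^ n) z) ≤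
      (2 / (μ + 1)) ^ n * T.orbitSup z := by
    intro n
    induction n with
    | zero => intro z; simp
    | succ n ih =>
      intro z
      rw [pow_succ, mul_apply_eq_comp, pow_succ, mul_assoc]
      exact (ih _).trans (mul_le_mul_of_nonneg_left (hstep z) (by positivity))
  refine ContinuousLinearMap.opNorm_le_bound _ (by positivity) fun z => ?_
  calc _ ≤ _ := C0Semigroup.norm_le_orbitSup hT _
    _ ≤ _ := hiter n z
    _ ≤ (2 / (μ + 1)) ^ n * (M * ‖z‖) := by
        gcongr
        exact C0Semigroup.orbitSup_le hT z
    _ = _ := by rw [div_pow]; ring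

end Cogenerator

/-! ### Exponentials of Yosida approximations. -/

section Exp

open NormedSpace

theorem exp_add_of_commute_of_rclike (𝕜 : Type*) {𝔸 : Type*} [RCLike 𝕜] [NormedRing 𝔸]
    [NormedAlgebra 𝕜 𝔸] [CompleteSpace 𝔸] {a b : 𝔸} (h : Commute a b) :
    exp (a + b) = exp a * exp b := by
  let _ : NormedAlgebra ℚ 𝔸 := NormedAlgebra.restrictScalars ℚ 𝕜 𝔸
  exact exp_add_of_commute h

variable {𝕜 𝔸 : Type*} [RCLike 𝕜] [NormedRing 𝔸] [NormedAlgebra 𝕜 𝔸]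

theorem exp_real_smul_one (r : ℝ) :
    exp ((r : 𝕜) • (1 : 𝔸)) = ((Real.exp r : ℝ) : 𝕜) • (1 : 𝔸) := by
  have h1 : ((Real.exp r : ℝ) : 𝕜) = exp (r : 𝕜) := by
    rw [Real.exp_eq_exp_ℝ]
    exact algebraMap_exp_comm (𝕂 := ℝ) (𝔸 := 𝕜) r
  rw [h1, ← Algebra.algebraMap_eq_smul_one, ← Algebra.algebraMap_eq_smul_one, algebraMap_exp_comm]

/-- Bounding each power, rather than powers of ‖R‖, keeps M a single factor of the series. -/
theorem norm_exp_smul_le {R : 𝔸} {l M : ℝ} (hR : ∀ n : ℕ, ‖R ^ n‖ ≤ M / l ^ n)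
    {r : ℝ} (hr : 0 ≤ r) : ‖exp ((r : 𝕜) • R)‖ ≤ M * Real.exp (r / l) := by
  rw [exp_eq_tsum 𝕜]
  have hsum : HasSum (fun n : ℕ => M * ((r / l) ^ n / n.factorial)) (M * Real.exp (r / l)) := by
    have := (NormedSpace.expSeries_div_hasSum_exp (r / l)).mul_left M
    rwa [← Real.exp_eq_exp_ℝ] at this
  refine tsum_of_norm_bounded hsum fun n => ?_
  rw [smul_pow, norm_smul, norm_smul, norm_inv, RCLike.norm_natCast, norm_pow, RCLike.norm_ofReal,
    abs_of_nonneg hr]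
  calc (n.factorial : ℝ)⁻¹ * (r ^ n * ‖R ^ n‖) ≤ (n.factorial : ℝ)⁻¹ * (r ^ n * (M / l ^ n)) := by
        gcongr
        exact hR n
    _ = _ := by rw [div_pow]; ring

/-- The exponential of a Yosida approximation is bounded. -/
theorem norm_exp_yosida_le [CompleteSpace 𝔸] {R : 𝔸} {l M : ℝ} (hl : 0 < l) (hR : ∀ n : ℕ, ‖R ^ n‖ ≤ M / l ^ n)
    {t : ℝ} (ht : 0 ≤ t) :
    ‖exp ((t : 𝕜) • (((l : 𝕜) ^ 2) • R - (l : 𝕜) • (1 : 𝔸)))‖ ≤ M := by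
  have e : (t : 𝕜) • (((l : 𝕜) ^ 2) • R - (l : 𝕜) • (1 : 𝔸)) =
      ((-(t * l) : ℝ) : 𝕜) • (1 : 𝔸) + ((t * l ^ 2 : ℝ) : 𝕜) • R := by
    push_cast
    module
  rw [e, exp_add_of_commute_of_rclike 𝕜 (((Commute.one_left R).smul_left _).smul_right _),
    exp_real_smul_one, smul_one_mul, norm_smul, RCLike.norm_ofReal, Real.abs_exp]
  calc _ ≤ Real.exp (-(t * l)) * (M * Real.exp (t * l ^ 2 / l)) := by
        gcongr
        exact norm_exp_smul_le hR (by positivity)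
    _ = M * (Real.exp (-(t * l)) * Real.exp (t * l)) := by
        rw [show t * l ^ 2 / l = t * l by field_simp]
        ring
    _ = M := by rw [← Real.exp_add]; simp

end Exp

/-! ### Estimates for orbits of exponentials. -/

section Orbit

open NormedSpace

variable {𝕜 X : Type*} [RCLike 𝕜] [NormedAddCommGroup X] [NormedSpace 𝕜 X] [CompleteSpace X]

theorem continuous_exp_smul_apply (a : X →L[𝕜] X) (x : X) :
    Continuous fun t : ℝ => exp ((t : 𝕜) • a) x := by
  have h1 : Continuous fun t : 𝕜 => exp (t • a) :=
    continuous_iff_continuousAt.2 fun t => (hasDerivAt_exp_smul_const a t).continuousAt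
  exact (h1.comp RCLike.continuous_ofReal).clm_apply continuous_const

variable [NormedSpace ℝ X] [IsScalarTower ℝ 𝕜 X]

theorem hasDerivAt_exp_smul_apply (a : X →L[𝕜] X) (x : X) (t : ℝ) :
    HasDerivAt (fun s : ℝ => exp ((s : 𝕜) • a) x) (exp ((t : 𝕜) • a) (a x)) t := by
  have h1 : HasDerivAt (fun u : 𝕜 => exp (u • a) x) (exp ((t : 𝕜) • a) (a x)) (t : 𝕜) := by
    simpa using (hasDerivAt_exp_smul_const a (t : 𝕜)).clm_apply (hasDerivAt_const (t : 𝕜) x)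
  have h2 : HasDerivAt (fun s : ℝ => (s : 𝕜)) (1 : 𝕜) t := by
    simpa using (RCLike.ofRealCLM (K := 𝕜)).hasDerivAt (x := t)
  have h3 := HasDerivAt.scomp t h1 h2
  rwa [one_smul] at h3

/-- The path s ↦ exp(sa) exp((t-s)b) x joins the two orbits, and its derivative applies an operator
of norm at most M² to a x - b x. -/
theorem norm_exp_sub_exp_apply_le {a b : X →L[𝕜] X} (hab : Commute a b) {M : ℝ} (hM : 0 ≤ M)
    (ha : ∀ t : ℝ, 0 ≤ t → ‖exp ((t : 𝕜) • a)‖ ≤ M) (hb : ∀ t : ℝ, 0 ≤ t → ‖exp ((t : 𝕜) • b)‖ ≤ M)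
    {t : ℝ} (ht : 0 ≤ t) (x : X) :
    ‖exp ((t : 𝕜) • a) x - exp ((t : 𝕜) • b) x‖ ≤ M ^ 2 * ‖a x - b x‖ * t := by
  have hc : Commute (a - b) b := hab.sub_left (Commute.refl b)
  have hsplit : ∀ s : ℝ, exp ((s : 𝕜) • (a - b)) * exp ((t : 𝕜) • b) =
      exp ((s : 𝕜) • a) * exp (((t - s : ℝ) : 𝕜) • b) := by
    intro s
    rw [← exp_add_of_commute_of_rclike 𝕜 ((hc.smul_left _).smul_right _),
      ← exp_add_of_commute_of_rclike 𝕜 ((hab.smul_left _).smul_right _)]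
    congr 1
    push_cast
    module
  have hd : ∀ s ∈ Set.Icc (0 : ℝ) t, HasDerivWithinAt
      (fun s : ℝ => exp ((s : 𝕜) • (a - b)) (exp ((t : 𝕜) • b) x))
      (exp ((s : 𝕜) • (a - b)) ((a - b) (exp ((t : 𝕜) • b) x))) (Set.Icc 0 t) s := fun s _ =>
    (hasDerivAt_exp_smul_apply (a - b) (exp ((t : 𝕜) • b) x) s).hasDerivWithinAt
  have hcb : Commute (a - b) (exp ((t : 𝕜) • b)) := by
    let _ : NormedAlgebra ℚ (X →L[𝕜] X) := NormedAlgebra.restrictScalars ℚ 𝕜 _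
    exact (hc.smul_right _).exp_right
  have hbound : ∀ s ∈ Set.Ico (0 : ℝ) t,
      ‖exp ((s : 𝕜) • (a - b)) ((a - b) (exp ((t : 𝕜) • b) x))‖ ≤ M ^ 2 * ‖a x - b x‖ := by
    intro s hs
    have h1 : exp ((s : 𝕜) • (a - b)) ((a - b) (exp ((t : 𝕜) • b) x)) =
        (exp ((s : 𝕜) • a) * exp (((t - s : ℝ) : 𝕜) • b)) (a x - b x) := by
      rw [← hsplit, ← mul_apply_eq_comp, ← mul_apply_eq_comp, mul_assoc, hcb.eq, ← mul_assoc,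
        mul_apply_eq_comp, sub_apply]
    rw [h1]
    refine ContinuousLinearMap.le_of_opNorm_le _ ?_ _
    rw [sq]
    exact (norm_mul_le _ _).trans
      (mul_le_mul (ha s hs.1) (hb _ (sub_nonneg.2 hs.2.le)) (norm_nonneg _) hM)
  have := norm_image_sub_le_of_norm_deriv_le_segment' hd hbound t ⟨ht, le_rfl⟩
  have e1 : exp ((t : 𝕜) • (a - b)) (exp ((t : 𝕜) • b) x) = exp ((t : 𝕜) • a) x := by
    rw [← mul_apply_eq_comp, hsplit]
    simp
  simp only [e1] at this
  simpa using this

/-- The bound involves `a` only through M, ‖a x - y‖ and ε, so it survives a strong limit in which a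
x tends to y. -/
theorem norm_exp_apply_sub_sub_le {a : X →L[𝕜] X} {M ε t : ℝ}
    (ha : ∀ t : ℝ, 0 ≤ t → ‖exp ((t : 𝕜) • a)‖ ≤ M) (ht : 0 ≤ t) {x y : X}
    (hε : ∀ s : ℝ, 0 ≤ s → s ≤ t → ‖exp ((s : 𝕜) • a) y - y‖ ≤ ε) :
    ‖exp ((t : 𝕜) • a) x - x - (t : 𝕜) • y‖ ≤ (M * ‖a x - y‖ + ε) * t := by
  have hd : ∀ s ∈ Set.Icc (0 : ℝ) t, HasDerivWithinAt
      (fun s : ℝ => exp ((s : 𝕜) • a) x - s • y)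
      (exp ((s : 𝕜) • a) (a x) - y) (Set.Icc 0 t) s := fun s _ => by
    have := (hasDerivAt_exp_smul_apply a x s).sub ((hasDerivAt_id s).smul_const y)
    rw [one_smul] at this
    exact this.hasDerivWithinAt
  have hbound : ∀ s ∈ Set.Ico (0 : ℝ) t,
      ‖exp ((s : 𝕜) • a) (a x) - y‖ ≤ M * ‖a x - y‖ + ε := by
    intro s hs
    have h1 : exp ((s : 𝕜) • a) (a x) - y =
        exp ((s : 𝕜) • a) (a x - y) + (exp ((s : 𝕜) • a) y - y) := by
      rw [map_sub]; abel
    rw [h1]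
    exact (norm_add_le _ _).trans (add_le_add
      (ContinuousLinearMap.le_of_opNorm_le _ (ha s hs.1) _) (hε s hs.1 hs.2.le))
  have := norm_image_sub_le_of_norm_deriv_le_segment' hd hbound t ⟨ht, le_rfl⟩
  simp only [RCLike.ofReal_zero, zero_smul, exp_zero, one_apply_eq_self, sub_zero] at this
  rwa [sub_right_comm, RCLike.real_smul_eq_coe_smul (K := 𝕜)] at this

end Orbit

/-! ### Hille–Yosida generation. -/

section Generation

open NormedSpace

variable {𝕜 X : Type*} [RCLike 𝕜] [NormedAddCommGroup X] [NormedSpace 𝕜 X] [CompleteSpace X]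
  [NormedSpace ℝ X] [IsScalarTower ℝ 𝕜 X]

theorem uniformCauchySeqOn_exp {a : ℕ → X →L[𝕜] X} (hcomm : ∀ m n, Commute (a m) (a n)) {M : ℝ}
    (hM : 0 < M) (ha : ∀ n, ∀ t : ℝ, 0 ≤ t → ‖exp ((t : 𝕜) • a n)‖ ≤ M) {D : Set X} (hD : Dense D)
    (hconv : ∀ x ∈ D, ∃ y, Tendsto (fun n => a n x) atTop (𝓝 y)) (x : X) (τ : ℝ≥0) :
    UniformCauchySeqOn (fun n (t : ℝ≥0) => exp (((t : ℝ) : 𝕜) • a n) x) atTop (Set.Iic τ) := by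
  rw [Metric.uniformCauchySeqOn_iff]
  intro ε hε
  obtain ⟨z, hz, hzD⟩ := Metric.dense_iff.1 hD x (ε / (4 * M)) (by positivity)
  rw [Metric.mem_ball, dist_eq_norm, norm_sub_rev] at hz
  obtain ⟨y, hy⟩ := hconv z hzD
  -- `τ + 1` instead of `τ` keeps the denominator positive when `τ = 0`.
  obtain ⟨N, hN⟩ := Metric.cauchySeq_iff.1 hy.cauchySeq (ε / (2 * (M ^ 2 * (τ + 1))))
    (by positivity)
  refine ⟨N, fun m hm n hn t ht => ?_⟩
  have hb : ∀ k, ‖exp (((t : ℝ) : 𝕜) • a k) (x - z)‖ ≤ ε / 4 := fun k => by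
    refine (ContinuousLinearMap.le_of_opNorm_le _ (ha k t t.2) _).trans ?_
    calc M * ‖x - z‖ ≤ M * (ε / (4 * M)) := by gcongr
      _ = ε / 4 := by field_simp
  have hmid : ‖exp (((t : ℝ) : 𝕜) • a m) z - exp (((t : ℝ) : 𝕜) • a n) z‖ < ε / 2 := by
    refine (norm_exp_sub_exp_apply_le (hcomm m n) hM.le (ha m) (ha n) t.2 z).trans_lt ?_
    have h1 := hN m hm n hn
    rw [dist_eq_norm] at h1
    have h2 : (t : ℝ) ≤ τ := ht
    calc M ^ 2 * ‖a m z - a n z‖ * t ≤ M ^ 2 * ‖a m z - a n z‖ * (τ + 1) := by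
          gcongr
          linarith
      _ < M ^ 2 * (ε / (2 * (M ^ 2 * (τ + 1)))) * (τ + 1) := by gcongr
      _ = ε / 2 := by field_simp
  have e : exp (((t : ℝ) : 𝕜) • a m) x - exp (((t : ℝ) : 𝕜) • a n) x =
      exp (((t : ℝ) : 𝕜) • a m) (x - z) - exp (((t : ℝ) : 𝕜) • a n) (x - z) +
        (exp (((t : ℝ) : 𝕜) • a m) z - exp (((t : ℝ) : 𝕜) • a n) z) := by
    simp only [map_sub]
    abel
  rw [dist_eq_norm, e]
  calc _ ≤ _ := norm_add_le _ _
    _ < (ε / 4 + ε / 4) + ε / 2 := by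
        refine add_lt_add_of_le_of_lt ?_ hmid
        exact (norm_sub_le _ _).trans (add_le_add (hb m) (hb n))
    _ = ε := by ring

/-- If `exp (t a n)` is bounded uniformly in `n` and `t ≥ 0`, the `a n` commute and converge on a
dense set, then `exp (t a n)` converges strongly to a `C₀`-semigroup whose generator extends
`lim a n`. -/
theorem exists_semigroup_of_tendsto {a : ℕ → X →L[𝕜] X} (hcomm : ∀ m n, Commute (a m) (a n))
    {M : ℝ} (hM : 0 < M) (ha : ∀ n, ∀ t : ℝ, 0 ≤ t → ‖exp ((t : 𝕜) • a n)‖ ≤ M) {D : Set X}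
    (hD : Dense D) (hconv : ∀ x ∈ D, ∃ y, Tendsto (fun n => a n x) atTop (𝓝 y)) :
    ∃ T : C0Semigroup 𝕜 X, (∀ t, ‖T.op t‖ ≤ M) ∧
      ∀ x y, Tendsto (fun n => a n x) atTop (𝓝 y) → T.HasGenValue x y := by
  have hcau := uniformCauchySeqOn_exp hcomm hM ha hD hconv
  have hlim : ∀ (t : ℝ≥0) (x : X), ∃ y,
      Tendsto (fun n => exp (((t : ℝ) : 𝕜) • a n) x) atTop (𝓝 y) := fun t x =>
    cauchySeq_tendsto_of_complete ((hcau x t).cauchySeq (Set.mem_Iic.2 le_rfl))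
  choose L hL using hlim
  have hunif : ∀ x (τ : ℝ≥0), TendstoUniformlyOn
      (fun n (t : ℝ≥0) => exp (((t : ℝ) : 𝕜) • a n) x) (fun t => L t x) atTop (Set.Iic τ) :=
    fun x τ => (hcau x τ).tendstoUniformlyOn_of_tendsto fun t _ => hL t x
  have hLcont : ∀ x, Continuous fun t => L t x := by
    intro x
    refine continuous_iff_continuousAt.2 fun t => ?_
    refine ContinuousOn.continuousAt (s := Set.Iic (t + 1)) ?_ (Iic_mem_nhds (by simp))
    refine (hunif x (t + 1)).continuousOn (Frequently.of_forall fun n => ?_)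
    exact ((continuous_exp_smul_apply (a n) x).comp NNReal.continuous_coe).continuousOn
  have hLnorm : ∀ t x, ‖L t x‖ ≤ M * ‖x‖ := fun t x =>
    le_of_tendsto (hL t x).norm (Eventually.of_forall fun n =>
      ContinuousLinearMap.le_of_opNorm_le _ (ha n t t.2) x)
  let op : ℝ≥0 → X →L[𝕜] X := fun t => LinearMap.mkContinuous
    { toFun := L t
      map_add' := fun x y => tendsto_nhds_unique (hL t (x + y))
        (((hL t x).add (hL t y)).congr fun n => (map_add _ x y).symm)
      map_smul' := fun c x => tendsto_nhds_unique (hL t (c • x))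
        (((hL t x).const_smul c).congr fun n => (map_smul _ c x).symm) } M (hLnorm t)
  let T : C0Semigroup 𝕜 X :=
    { op := op
      op_zero := by
        ext x
        exact tendsto_nhds_unique (hL 0 x) (by simp)
      op_add := by
        intro s t
        ext x
        refine tendsto_nhds_unique (hL (s + t) x) ?_
        have h1 := hL s (L t x)
        have h2 : Tendsto (fun n => exp (((s : ℝ) : 𝕜) • a n)
            (exp (((t : ℝ) : 𝕜) • a n) x - L t x)) atTop (𝓝 0) := by
          refine squeeze_zero_norm (fun n =>
            ContinuousLinearMap.le_of_opNorm_le _ (ha n s s.2) _) ?_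
          simpa using (((hL t x).sub_const (L t x)).norm).const_mul M
        have h3 := h2.add h1
        rw [zero_add] at h3
        refine h3.congr fun n => ?_
        rw [map_sub, sub_add_cancel, ← mul_apply_eq_comp, NNReal.coe_add, RCLike.ofReal_add,
          add_smul, exp_add_of_commute_of_rclike 𝕜
            (((Commute.refl (a n)).smul_left _).smul_right _)]
      continuous_orbit := hLcont }
  refine ⟨T, fun t => ContinuousLinearMap.opNorm_le_bound _ hM.le (hLnorm t), fun x y hxy => ?_⟩
  have hL0 : L 0 y = y := tendsto_nhds_unique (hL 0 y) (by simp)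
  refine Metric.tendsto_nhds.2 fun ε hε => ?_
  -- The mean value estimate needs smallness at every s ≤ h, not just at h.
  have hev : ∀ᶠ h in 𝓝 (0 : ℝ≥0), ∀ s : ℝ≥0, s ≤ h → ‖L s y - y‖ < ε / 4 := by
    have h1 : ∀ᶠ s in 𝓝 (0 : ℝ≥0), ‖L s y - y‖ < ε / 4 := by
      have : Tendsto (fun s => ‖L s y - y‖) (𝓝 0) (𝓝 0) := by
        simpa [hL0] using (((hLcont y).tendsto 0).sub_const y).norm
      exact this.eventually (gt_mem_nhds (by positivity))
    obtain ⟨δ, hδ, hball⟩ := Metric.eventually_nhds_iff.1 h1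
    refine Metric.eventually_nhds_iff.2 ⟨δ, hδ, fun h hh s hs => hball (lt_of_le_of_lt ?_ hh)⟩
    simpa [NNReal.dist_eq] using hs
  filter_upwards [self_mem_nhdsWithin, nhdsWithin_le_nhds hev] with h hh hsmall
  have hpos : (0 : ℝ) < h := hh
  have hne : ((h : ℝ) : 𝕜) ≠ 0 := by exact_mod_cast hpos.ne'
  have hmain : ‖L h x - x - ((h : ℝ) : 𝕜) • y‖ ≤ (3 * ε / 4) * h := by
    refine le_of_tendsto (((hL h x).sub_const x).sub_const _).norm ?_
    have hu := Metric.tendstoUniformlyOn_iff.1 (hunif y h) (ε / 4) (by positivity)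
    have hx : ∀ᶠ n in atTop, M * ‖a n x - y‖ < ε / 4 := by
      have : Tendsto (fun n => M * ‖a n x - y‖) atTop (𝓝 0) := by
        simpa using ((hxy.sub_const y).norm).const_mul M
      exact this.eventually (gt_mem_nhds (by positivity))
    filter_upwards [hu, hx] with n hn hxn
    refine (norm_exp_apply_sub_sub_le (ha n) hpos.le (ε := ε / 2) fun s hs0 hsh => ?_).trans ?_
    · have h1 := hn ⟨s, hs0⟩ hsh
      have h2 := hsmall ⟨s, hs0⟩ hsh
      rw [dist_eq_norm, norm_sub_rev] at h1
      have h3 := norm_add_le (exp ((s : 𝕜) • a n) y - L ⟨s, hs0⟩ y) (L ⟨s, hs0⟩ y - y)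
      rw [sub_add_sub_cancel] at h3
      change ‖exp ((s : 𝕜) • a n) y - L ⟨s, hs0⟩ y‖ < ε / 4 at h1
      linarith
    · gcongr
      linarith
  have e : (((h : ℝ) : 𝕜)⁻¹) • (T.op h x - x) - y =
      (((h : ℝ) : 𝕜)⁻¹) • (L h x - x - ((h : ℝ) : 𝕜) • y) := by
    rw [smul_sub _ (L h x - x), inv_smul_smul₀ hne]
    rfl
  rw [dist_eq_norm, e, norm_smul, norm_inv, RCLike.norm_ofReal, abs_of_pos hpos, inv_mul_eq_div,
    div_lt_iff₀ hpos]
  refine hmain.trans_lt ?_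
  gcongr
  linarith

/-- Hille–Yosida generation, for the operator `A` with `S = (A - 1)⁻¹` and resolvents
`R n = (l n - A)⁻¹`. -/
theorem exists_semigroup_of_resolvent_bound {S : X →L[𝕜] X} (hS : DenseRange S)
    {R : ℕ → X →L[𝕜] X} {l : ℕ → ℝ} (hl : Tendsto l atTop atTop) (hl0 : ∀ n, 0 < l n) {M : ℝ}
    (hM : 0 < M) (hcomm : ∀ m n, Commute (R m) (R n))
    (hR : ∀ n k, ‖R n ^ k‖ ≤ M / l n ^ k)
    (hRS : ∀ n y, (l n : 𝕜) • R n (S y) = S y + R n (S y + y)) :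
    ∃ T : C0Semigroup 𝕜 X, (∀ t, ‖T.op t‖ ≤ M) ∧ ∀ y, T.HasGenValue (S y) (S y + y) := by
  have hR1 : ∀ n x, ‖R n x‖ ≤ M / l n * ‖x‖ := fun n x =>
    ContinuousLinearMap.le_of_opNorm_le _ (by simpa using hR n 1) x
  -- On the range of `S` the error is R n (S w + w) = O(1/l n); density and ‖l n R n‖ ≤ M extend
  -- this to all x.
  have hid : ∀ x, Tendsto (fun n => (l n : 𝕜) • R n x) atTop (𝓝 x) := by
    intro x
    rw [Metric.tendsto_atTop']
    intro ε hε
    obtain ⟨_, hz, ⟨w, rfl⟩⟩ := Metric.dense_iff.1 hS x (ε / (2 * (M + 1))) (by positivity)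
    rw [Metric.mem_ball, dist_eq_norm, norm_sub_rev] at hz
    have h0 : Tendsto (fun n => M / l n * ‖S w + w‖) atTop (𝓝 0) := by
      simpa using (hl.const_div_atTop M).mul_const ‖S w + w‖
    obtain ⟨N, hN⟩ := eventually_atTop.1 (h0.eventually (gt_mem_nhds (half_pos hε)))
    refine ⟨N, fun n hn => ?_⟩
    have e : (l n : 𝕜) • R n x - x =
        (l n : 𝕜) • R n (x - S w) - (x - S w) + R n (S w + w) := by
      rw [map_sub, smul_sub, hRS]
      abel
    have h1 : ‖(l n : 𝕜) • R n (x - S w)‖ ≤ M * ‖x - S w‖ := by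
      rw [norm_smul, RCLike.norm_ofReal, abs_of_pos (hl0 n)]
      calc l n * ‖R n (x - S w)‖ ≤ l n * (M / l n * ‖x - S w‖) := by
            gcongr
            · exact (hl0 n).le
            · exact hR1 n _
        _ = _ := by have := (hl0 n).ne'; field_simp
    rw [dist_eq_norm, e]
    calc _ ≤ _ := norm_add_le _ _
      _ ≤ (M * ‖x - S w‖ + ‖x - S w‖) + M / l n * ‖S w + w‖ :=
          add_le_add ((norm_sub_le _ _).trans (add_le_add h1 le_rfl)) (hR1 n _)
      _ < (M + 1) * (ε / (2 * (M + 1))) + ε / 2 := by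
          refine add_lt_add ?_ (hN n hn.le)
          rw [← add_one_mul]
          gcongr
      _ = ε := by field_simp; ring
  set a : ℕ → X →L[𝕜] X := fun n => ((l n : 𝕜) ^ 2) • R n - (l n : 𝕜) • 1 with ha
  have haS : ∀ y, Tendsto (fun n => a n (S y)) atTop (𝓝 (S y + y)) := by
    intro y
    -- By `hRS`, a n (S y) = l n R n (S y + y).
    refine (hid (S y + y)).congr fun n => ?_
    simp only [ha, sub_apply, smul_apply, one_apply_eq_self]
    rw [sq, mul_smul, hRS, smul_add]
    abel
  have hacomm : ∀ m n, Commute (a m) (a n) := fun m n => by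
    refine Commute.sub_left (Commute.sub_right ?_ ?_) (Commute.sub_right ?_ ?_)
    · exact ((hcomm m n).smul_left _).smul_right _
    · exact ((Commute.one_right _).smul_left _).smul_right _
    · exact ((Commute.one_left _).smul_left _).smul_right _
    · exact ((Commute.one_left _).smul_left _).smul_right _
  obtain ⟨T, hT, hgen⟩ := exists_semigroup_of_tendsto hacomm hM
    (fun n t ht => norm_exp_yosida_le (hl0 n) (hR n) ht) (D := Set.range S) hS
    (by rintro _ ⟨y, rfl⟩; exact ⟨_, haS y⟩)
  exact ⟨T, hT, fun y => hgen _ _ (haS y)⟩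

end Generation

/-! ### From the bounds back to the cogenerator. -/

theorem isCogenerator_of_hasGenValue {𝕜 X : Type*} [RCLike 𝕜] [NormedAddCommGroup X]
    [NormedSpace 𝕜 X] {V S : X →L[𝕜] X} {T : C0Semigroup 𝕜 X} {M : ℝ}
    (hT : ∀ t, ‖T.op t‖ ≤ M) (hV : ∀ y, V y = y + (2 : 𝕜) • S y)
    (hgen : ∀ y, T.HasGenValue (S y) (S y + y)) : IsCogenerator V T := by
  refine ⟨S, ⟨fun y => ?_, fun x => ?_⟩, fun y => ?_⟩
  · obtain ⟨h, e⟩ := (hgen y).exists_generator_apply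
    exact ⟨h, by rw [e, one_smul, add_sub_cancel_left]⟩
  · rw [one_smul]
    set w : X := T.generator x - x with hw
    -- z = x - S w satisfies A z = z, so dissipativity at 2 gives 2N(z) ≤ N(z) for N = `orbitSup`,
    -- and z = 0.
    have h1 := (T.hasGenValue_generator x).add ((hgen w).smul (-1))
    have e1 : T.generator x + (-1 : 𝕜) • (S w + w) = x + (-1 : 𝕜) • S w := by
      rw [hw, smul_add]
      module
    rw [e1] at h1
    have h2 := h1.mul_orbitSup_le hT (l := 2) zero_le_two
    have e2 : ((2 : ℝ) : 𝕜) • ((x : X) + (-1 : 𝕜) • S w) - ((x : X) + (-1 : 𝕜) • S w) =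
        x + (-1 : 𝕜) • S w := by
      push_cast
      module
    rw [e2] at h2
    have h3 := C0Semigroup.norm_le_orbitSup hT ((x : X) + (-1 : 𝕜) • S w)
    have h4 : (x : X) + (-1 : 𝕜) • S w = 0 := norm_le_zero_iff.1 (by linarith)
    rw [neg_one_smul, ← sub_eq_add_neg, sub_eq_zero] at h4
    exact h4.symm
  · obtain ⟨h, e⟩ := (hgen y).exists_generator_apply
    exact ⟨h, by rw [e, hV, two_smul]; abel⟩

theorem commute_one_sub_mul_resolvent {𝕜 A : Type*} [CommRing 𝕜] [Ring A] [Algebra 𝕜 A] (V : A)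
    (μ ν : 𝕜) : Commute ((1 - V) * resolvent V μ) ((1 - V) * resolvent V ν) := by
  have h1 : ∀ ξ : 𝕜, Commute (1 - V) (algebraMap 𝕜 A ξ - V) := fun ξ =>
    ((Commute.one_left _).sub_left ((Algebra.commute_algebraMap_right ξ V).sub_right
      (Commute.refl V)))
  have h2 : Commute (algebraMap 𝕜 A μ - V) (algebraMap 𝕜 A ν - V) :=
    ((Algebra.commute_algebraMap_left μ _).sub_left
      ((Algebra.commute_algebraMap_right ν V).sub_right (Commute.refl V)))
  have h3 : ∀ ξ : 𝕜, Commute (1 - V) (resolvent V ξ) := fun ξ => by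
    unfold resolvent Ring.inverse
    split_ifs with h
    · exact Commute.units_inv_right (by simpa using h1 ξ)
    -- Off the resolvent set `Ring.inverse` takes the value 0.
    · exact Commute.zero_right _
  exact ((Commute.refl _).mul_right (h3 ν)).mul_left
    ((h3 μ).symm.mul_right h2.ringInverse_ringInverse)

theorem exists_semigroup_of_norm_pow_le {𝕜 X : Type*} [RCLike 𝕜] [NormedAddCommGroup X]
    [NormedSpace 𝕜 X] [CompleteSpace X] {V : X →L[𝕜] X} {M : ℝ} (hM : 0 < M)
    (hdense : DenseRange (V - 1 : X →L[𝕜] X)) {μ₀ : ℝ} (hμ₀ : 1 < μ₀)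
    (hρ : ∀ μ : ℝ, 1 < μ → μ < μ₀ → (μ : 𝕜) ∈ resolventSet 𝕜 V)
    (hbound : ∀ μ : ℝ, 1 < μ → μ < μ₀ → ∀ n : ℕ,
      ‖((1 - V) * resolvent V (μ : 𝕜)) ^ n‖ ≤ 2 ^ n * M / (μ + 1) ^ n) :
    ∃ T : C0Semigroup 𝕜 X, IsCogenerator V T ∧ ∀ t : ℝ≥0, ‖T.op t‖ ≤ M := by
  let _ : NormedSpace ℝ X := NormedSpace.restrictScalars ℝ 𝕜 X
  have : IsScalarTower ℝ 𝕜 X := RestrictScalars.isScalarTower ℝ 𝕜 X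
  -- μ = 1 + d n decreases to 1; `n + 2` keeps it strictly below μ₀ already at n = 0.
  set d : ℕ → ℝ := fun n => (μ₀ - 1) / (n + 2) with hd
  have hδ : 0 < μ₀ - 1 := sub_pos.2 hμ₀
  have hdpos : ∀ n, 0 < d n := fun n => by positivity
  have hdlt : ∀ n, 1 + d n < μ₀ := fun n => by
    have : d n < μ₀ - 1 := div_lt_self hδ (by have : (0 : ℝ) ≤ n := n.cast_nonneg; linarith)
    linarith
  have hd1 : ∀ n, 1 < 1 + d n := fun n => by linarith [hdpos n]
  -- This is (μ+1)/(μ-1) at μ = 1 + d n; `S` and `R n` below play (A - I)⁻¹ and R(l n, A).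
  set l : ℕ → ℝ := fun n => (d n + 2) / d n with hl
  set S : X →L[𝕜] X := (2 : 𝕜)⁻¹ • (V - 1) with hS
  set P : ℕ → X →L[𝕜] X := fun n => (1 - V) * resolvent V ((1 + d n : ℝ) : 𝕜) with hP
  set R : ℕ → X →L[𝕜] X := fun n => ((d n / 2 : ℝ) : 𝕜) • P n with hR
  have hV : ∀ y, V y = y + (2 : 𝕜) • S y := fun y => by
    simp [hS]
  have hSd : DenseRange S := by
    have h1 : (S : X → X) = (fun x => (2 : 𝕜)⁻¹ • x) ∘ (V - 1 : X →L[𝕜] X) := by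
      ext y; simp [hS]
    rw [h1]
    refine DenseRange.comp (Function.Surjective.denseRange fun x => ⟨(2 : 𝕜) • x, ?_⟩) hdense
      (continuous_const_smul _)
    exact inv_smul_smul₀ two_ne_zero x
  have hlpos : ∀ n, 0 < l n := fun n => div_pos (by linarith [hdpos n]) (hdpos n)
  have hlim : Tendsto l atTop atTop := by
    have h1 : l = fun n : ℕ => 1 + ((n : ℝ) + 2) * (2 / (μ₀ - 1)) := by
      ext n
      simp only [hl, hd]
      field_simp
    rw [h1]
    refine tendsto_atTop_add_const_left _ _ (Tendsto.atTop_mul_const (by positivity) ?_)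
    exact tendsto_atTop_add_const_right _ _ tendsto_natCast_atTop_atTop
  have hPV : ∀ n y, P n (((1 + d n : ℝ) : 𝕜) • y - V y) = y - V y := by
    intro n y
    have h1 : resolvent V ((1 + d n : ℝ) : 𝕜) *
        (algebraMap 𝕜 (X →L[𝕜] X) ((1 + d n : ℝ) : 𝕜) - V) = 1 :=
      Ring.inverse_mul_cancel _ (spectrum.mem_resolventSet_iff.1 (hρ _ (hd1 n) (hdlt n)))
    have h2 : ((1 + d n : ℝ) : 𝕜) • y - V y =
        (algebraMap 𝕜 (X →L[𝕜] X) ((1 + d n : ℝ) : 𝕜) - V) y := by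
      simp [Algebra.algebraMap_eq_smul_one]
    rw [h2, ← mul_apply_eq_comp, hP]
    simp only
    rw [mul_assoc, h1, mul_one, sub_apply, one_apply_eq_self]
  have hRS : ∀ n y, (l n : 𝕜) • R n (S y) = S y + R n (S y + y) := by
    intro n y
    have hdn : ((d n : ℝ) : 𝕜) ≠ 0 := by exact_mod_cast (hdpos n).ne'
    have h1 : (l n : 𝕜) • S y - (S y + y) =
        -((d n : 𝕜)⁻¹ • (((1 + d n : ℝ) : 𝕜) • y - V y)) := by
      simp only [hl, hS, smul_apply, sub_apply, one_apply_eq_self]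
      push_cast
      match_scalars <;> field_simp <;> ring
    rw [← sub_eq_iff_eq_add, ← map_smul, ← map_sub, h1, map_neg, map_smul]
    simp only [hR, smul_apply, hPV]
    simp only [hS, smul_apply, sub_apply, one_apply_eq_self]
    push_cast
    match_scalars <;> field_simp
  have hRk : ∀ n k, ‖R n ^ k‖ ≤ M / l n ^ k := by
    intro n k
    have hdn := hdpos n
    simp only [hR]
    rw [smul_pow, norm_smul, norm_pow, RCLike.norm_ofReal, abs_of_pos (by linarith)]
    calc (d n / 2) ^ k * ‖P n ^ k‖ ≤ (d n / 2) ^ k * (2 ^ k * M / (1 + d n + 1) ^ k) := by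
          gcongr
          exact hbound _ (hd1 n) (hdlt n) k
      _ = M / l n ^ k := by
          simp only [hl]
          generalize d n = e at hdn
          rw [show 1 + e + 1 = e + 2 by ring, div_pow, div_pow]
          field_simp
  obtain ⟨T, hT, hgen⟩ := exists_semigroup_of_resolvent_bound hSd hlim hlpos hM
    (fun m n => ((commute_one_sub_mul_resolvent V _ _).smul_left _).smul_right _) hRk hRS
  exact ⟨T, isCogenerator_of_hasGenValue hT hV hgen, hT⟩

theorem IsCogenerator.denseRange {𝕜 X : Type*} [RCLike 𝕜] [NormedAddCommGroup X]
    [NormedSpace 𝕜 X] [CompleteSpace X] {V : X →L[𝕜] X} {T : C0Semigroup 𝕜 X}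
    (h : IsCogenerator V T) : DenseRange (V - 1 : X →L[𝕜] X) := by
  let _ : NormedSpace ℝ X := NormedSpace.restrictScalars ℝ 𝕜 X
  have : IsScalarTower ℝ 𝕜 X := RestrictScalars.isScalarTower ℝ 𝕜 X
  exact T.dense_generator_domain.mono h.domain_subset_range

theorem theorem2p3 {𝕜 X : Type*} [RCLike 𝕜] [NormedAddCommGroup X] [NormedSpace 𝕜 X]
    [CompleteSpace X] (V : X →L[𝕜] X) (M : ℝ) (hM : 1 ≤ M) :
    List.TFAE [
      ∃ T : C0Semigroup 𝕜 X, IsCogenerator V T ∧ ∀ t : ℝ≥0, ‖T.op t‖ ≤ M,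
      Function.Injective (V - 1 : X →L[𝕜] X) ∧ DenseRange (V - 1 : X →L[𝕜] X) ∧
        (∀ μ : ℝ, 1 < μ → (μ : 𝕜) ∈ resolventSet 𝕜 V) ∧
        ∀ μ : ℝ, 1 < μ → ∀ n : ℕ,
          ‖((1 - V) * resolvent V (μ : 𝕜)) ^ n‖ ≤ 2 ^ n * M / (μ + 1) ^ n,
      Function.Injective (V - 1 : X →L[𝕜] X) ∧ DenseRange (V - 1 : X →L[𝕜] X) ∧
        ∃ μ₀ : ℝ, 1 < μ₀ ∧
          (∀ μ : ℝ, 1 < μ → μ < μ₀ → (μ : 𝕜) ∈ resolventSet 𝕜 V) ∧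
          ∀ μ : ℝ, 1 < μ → μ < μ₀ → ∀ n : ℕ,
            ‖((1 - V) * resolvent V (μ : 𝕜)) ^ n‖ ≤ 2 ^ n * M / (μ + 1) ^ n] := by
  have hM0 : 0 < M := by linarith
  tfae_have 1 → 2 := by
    rintro ⟨T, hV, hT⟩
    have hρ : ∀ μ : ℝ, 1 < μ → (μ : 𝕜) ∈ resolventSet 𝕜 V := fun μ hμ =>
      mem_resolventSet_of_lower_bound (c := (1 + M)⁻¹) (by positivity)
        (fun _ hν y => hV.lower_bound hM0.le hT hν y) hμ
    exact ⟨hV.injective, hV.denseRange, hρ,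
      fun μ hμ n => hV.norm_pow_le hM0.le hT hμ (hρ μ hμ) n⟩
  tfae_have 2 → 3 := by
    rintro ⟨hi, hd, hρ, hb⟩
    exact ⟨hi, hd, 2, one_lt_two, fun μ hμ _ => hρ μ hμ, fun μ hμ _ => hb μ hμ⟩
  tfae_have 3 → 1 := by
    rintro ⟨-, hd, μ₀, hμ₀, hρ, hb⟩
    exact exists_semigroup_of_norm_pow_le hM0 hd hμ₀ hρ hb
  tfae_finish
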